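/- Let $d$ be a dimension. A lattice in $\mathbb{R}^d$ is the set $\Lambda$ of integer combinations of a basis $v_1,\dots,v_d$ of $\mathbb{R}^d$; its density is $1/|\det(v_1,\dots,v_d)|$ and its packing radius is $p(\Lambda)=\inf\{\|x-y\|/2 : x,y\in\Lambda,\ x\neq y\}$. For $X,Y\subseteq\mathbb{R}^d$ let $$d_B(X,Y)=\inf_{f\colon X\to Y\text{ bijection}}\ \sup_{x\in X}\|x-f(x)\|,\qquad d_{EB}(X,Y)=\inf_{\psi\in\mathrm{Iso}(\mathbb{R}^d)}d_B(X,\psi(Y)),$$ be the bottleneck distance and the Euclidean bottleneck distance, where $\mathrm{Iso}(\mathbb{R}^d)$ is the group of all isometries of $\mathbb{R}^d$ and the infimum over an empty set is $\infty$. (1) For all real $r>0$ and $\kappa>0$, the family of lattices $\Lambda$ in $\mathbb{R}^d$ of density $\kappa$ with $p(\Lambda)\ge r$ is bounded in the distance $d_{EB}$, that is, $\sup d_{EB}(\Lambda_1,\Lambda_2)<\infty$, where the supremum is over all $\Lambda_1,\Lambda_2$ in this family. (2) There are constants $c(d,r,\rho)\in[0,\infty)$, for all real $r>0$ and $\rho>0$,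 such that every lattice $\Lambda$ in $\mathbb{R}^d$ with $p(\Lambda)\ge r$ and density $\rho^d$ satisfies $$d_B\Big(\Lambda,\tfrac1\rho\mathbb{Z}^d\Big)\le c(d,r,\rho),$$ and $c(d,r,\rho)$ is non-increasing in $r$ (for fixed $\rho$) and non-increasing in $\rho$ (for fixed $r$). -/

import Mathlib

open scoped NNReal ENNReal Pointwise

/-- The packing radius `inf {‖x - y‖ / 2 | x, y ∈ X, x ≠ y}` of a set of points, with values in
`[0, ∞]`. -/
noncomputable def packingRadius {d : ℕ} (X : Set (EuclideanSpace ℝ (Fin d))) : ℝ≥0∞ :=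
  X.einfsep / 2

/-- The density of a lattice: one over the volume of its unit cell. -/
noncomputable def latticeDensity {d : ℕ} (L : Submodule ℤ (EuclideanSpace ℝ (Fin d))) : ℝ :=
  1 / ZLattice.covolume L

/-- The integer lattice `ℤ^d` in `ℝ^d`. -/
def integerLattice (d : ℕ) : Set (EuclideanSpace ℝ (Fin d)) :=
  {x | ∀ i, ∃ n : ℤ, x i = n}

/-- The bottleneck distance between two sets of points: the infimum over all bijections
`f : X → Y` of `sup_x ‖x - f x‖`, which is `∞` if there is no bijection. -/
noncomputable def bottleneckDist {d : ℕ} (X Y : Set (EuclideanSpace ℝ (Fin d))) : ℝ≥0∞ :=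
  ⨅ f : X ≃ Y, ⨆ x : X, edist (x : EuclideanSpace ℝ (Fin d)) (f x)

/-- The Euclidean bottleneck distance: the infimum of the bottleneck distances from `X` to the
images of `Y` under all isometries of `ℝ^d`. -/
noncomputable def euclideanBottleneckDist {d : ℕ} (X Y : Set (EuclideanSpace ℝ (Fin d))) :
    ℝ≥0∞ :=
  ⨅ ψ : EuclideanSpace ℝ (Fin d) ≃ᵢ EuclideanSpace ℝ (Fin d), bottleneckDist X (ψ '' Y)

/-- The family of all lattices (of full rank) in `ℝ^d` of density `κ` and packing radius at
least `r`. -/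
def lattices (d : ℕ) (r κ : ℝ) : Set (Submodule ℤ (EuclideanSpace ℝ (Fin d))) :=
  {L | (∃ _ : DiscreteTopology L, IsZLattice ℝ L) ∧
    ENNReal.ofReal r ≤ packingRadius (L : Set (EuclideanSpace ℝ (Fin d))) ∧
    latticeDensity L = κ}

/-- The diameter of a family of lattices in the Euclidean bottleneck distance. -/
noncomputable def euclideanBottleneckDiam {d : ℕ}
    (F : Set (Submodule ℤ (EuclideanSpace ℝ (Fin d)))) : ℝ≥0∞ :=
  ⨆ L₁ ∈ F, ⨆ L₂ ∈ F, euclideanBottleneckDist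
    (L₁ : Set (EuclideanSpace ℝ (Fin d))) (L₂ : Set (EuclideanSpace ℝ (Fin d)))

/-! Bounded covering radius is enough: if two lattices of equal covolume have fundamental domains in
balls of radii `M₁` and `M₂`, every set of `k` cells of one has the volume of `k` cells of the
other, so Hall's condition holds for matching points at distance at most `M₁ + M₂`. Hall gives
injections both ways (`exists_injective_dist_le`), and Schröder–Bernstein merges them. The covering
radius is bounded by packing (`exists_mem_lattice_dist_mul_measure_ball_le`): on a segment from a
point to its nearest lattice point, balls of radius `r` spaced by `2 * r` are disjoint modulo the
lattice, so their number times their volume is at most the covolume. -/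

open MeasureTheory Metric

/-! ### Covering radius from packing radius and covolume -/

section LatticeGeometry

variable {E : Type*} [NormedAddCommGroup E] [NormedSpace ℝ E]

/-- Two points on a segment from `0` to a point `z` whose nearest lattice point is `0` are
separated modulo the lattice by at least their distance along the segment. -/
theorem le_norm_smul_sub_smul_sub {z g : E} (hz : ‖z‖ ≤ ‖z - g‖) {a b : ℝ} (hb : 0 ≤ b)
    (ha : a ≤ 1) : (a - b) * ‖z‖ ≤ ‖a • z - b • z - g‖ := by
  -- Going from `g` to `z` through `g + b • z` and `a • z` cannot be shorter than `‖z‖`.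
  have h1 : z - g = (1 - a) • z + (a • z - b • z - g) + b • z := by
    rw [sub_smul, one_smul]; abel
  have h2 : ‖z - g‖ ≤ (1 - a) * ‖z‖ + ‖a • z - b • z - g‖ + b * ‖z‖ := by
    rw [h1]
    refine (norm_add₃_le).trans_eq ?_
    rw [norm_smul, norm_smul, Real.norm_of_nonneg (sub_nonneg.2 ha), Real.norm_of_nonneg hb]
  linarith

variable [FiniteDimensional ℝ E] [MeasurableSpace E] [BorelSpace E]
  (μ : Measure E) [μ.IsAddHaarMeasure]
  (L : Submodule ℤ E) [DiscreteTopology L] [IsZLattice ℝ L]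

/-- Representatives are exact, not merely almost everywhere, since the Hall argument picks a cell
for each individual point. -/
theorem exists_measurableSet_existsUnique_vadd_mem :
    ∃ F : Set E, MeasurableSet F ∧ ∀ z : E, ∃! g : L, g +ᵥ z ∈ F := by
  let b := Module.Free.chooseBasis ℤ L
  refine ⟨_, ZSpan.fundamentalDomain_measurableSet (b.ofZLatticeBasis ℝ), fun z => ?_⟩
  have h := ZSpan.exist_unique_vadd_mem_fundamentalDomain (b.ofZLatticeBasis ℝ) z
  have e := b.ofZLatticeBasis_span ℝ L
  obtain ⟨v, hv, hu⟩ := h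
  exact ⟨⟨v, e.le v.2⟩, hv, fun y hy => by rw [← hu ⟨y, e.ge y.2⟩ hy]⟩

variable {L} in
theorem measure_eq_covolume_of_existsUnique {F : Set E} {M : ℝ} (hF : MeasurableSet F)
    (hu : ∀ z : E, ∃! g : L, g +ᵥ z ∈ F) (hM : F ⊆ closedBall 0 M) :
    μ F = ENNReal.ofReal (ZLattice.covolume L μ) := by
  rw [ZLattice.covolume_eq_measure_fundamentalDomain L μ
    (IsAddFundamentalDomain.mk' hF.nullMeasurableSet hu),
    ofReal_measureReal ((measure_mono hM).trans_lt measure_closedBall_lt_top).ne]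

/-- A set whose lattice translates are pairwise disjoint has measure at most the covolume. -/
theorem measure_le_covolume_of_pairwise_disjoint {s : Set E} (hs : MeasurableSet s)
    (h : ∀ g ∈ L, ∀ x ∈ s, ∀ y ∈ s, x = g + y → g = 0) :
    μ s ≤ ENNReal.ofReal (ZLattice.covolume L μ) := by
  let b := Module.Free.chooseBasis ℤ L
  have hF := ZLattice.isAddFundamentalDomain b μ
  have hfin : μ (ZSpan.fundamentalDomain (b.ofZLatticeBasis ℝ)) ≠ ∞ :=
    (ZSpan.fundamentalDomain_isBounded _).measure_lt_top.ne
  rw [ZLattice.covolume_eq_measure_fundamentalDomain L μ hF, ofReal_measureReal hfin]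
  -- Blichfeldt's principle: a set larger than a fundamental domain meets one of its nontrivial
  -- translates.
  by_contra! hlt
  have : MeasurableVAdd L E := (inferInstance : MeasurableVAdd L.toAddSubgroup E)
  have : VAddInvariantMeasure L E μ := (inferInstance : VAddInvariantMeasure L.toAddSubgroup E μ)
  obtain ⟨x, y, hxy, hd⟩ :=
    exists_pair_mem_lattice_not_disjoint_vadd hF hs.nullMeasurableSet hlt
  obtain ⟨_, ⟨u, hu, rfl⟩, ⟨v, hv, huv⟩⟩ := Set.not_disjoint_iff.1 hd
  have huv : (y : E) + v = x + u := huv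
  refine hxy (Subtype.ext ?_)
  have := h (y - x) (L.sub_mem y.2 x.2) u hu v hv (by rw [sub_add_eq_add_sub, huv]; abel)
  exact (sub_eq_zero.1 this).symm

/-- The covering radius of a lattice with minimal distance at least `2 * r` is bounded in terms of
the covolume. -/
theorem exists_mem_lattice_dist_mul_measure_ball_le {r : ℝ} (hr : 0 < r)
    (hL : ∀ g ∈ L, g ≠ 0 → 2 * r ≤ ‖g‖) (z : E) :
    ∃ l ∈ L, dist z l * μ.real (ball 0 r) ≤ 2 * r * ZLattice.covolume L μ := by
  have hproper : ProperSpace E := FiniteDimensional.proper ℝ E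
  have hcl : IsClosed (L : Set E) := by
    have : DiscreteTopology L.toAddSubgroup := ‹DiscreteTopology L›
    exact AddSubgroup.isClosed_of_discrete (H := L.toAddSubgroup)
  obtain ⟨l, hl, hmin⟩ := hcl.exists_infDist_eq_dist ⟨0, L.zero_mem⟩ z
  refine ⟨l, hl, ?_⟩
  have hcov := (ZLattice.covolume_pos L μ).le
  set w := z - l with hw
  have hmin : ∀ g ∈ L, ‖w‖ ≤ ‖w - g‖ := fun g hg => by
    have := infDist_le_dist_of_mem (x := z) (L.add_mem hl hg)
    rw [hmin, dist_eq_norm, dist_eq_norm] at this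
    rwa [hw, sub_sub]
  rw [dist_eq_norm, ← hw]
  rcases (norm_nonneg w).eq_or_lt with h0 | hpos
  · rw [← h0, zero_mul]; positivity
  -- The `n` centres are the points of the segment from `0` to `w` at distances `2 * r * k` from
  -- `0`, including `k = 0`; hence `‖w‖ ≤ 2 * r * n`.
  set n := ⌊‖w‖ / (2 * r)⌋₊ + 1 with hn
  let a : ℕ → ℝ := fun k => 2 * r * k / ‖w‖
  have ha0 : ∀ k, 0 ≤ a k := fun k => by positivity
  have ha1 : ∀ k < n, a k ≤ 1 := fun k hk => by
    have : (k : ℝ) ≤ ‖w‖ / (2 * r) :=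
      (Nat.le_floor_iff (by positivity)).1 (Nat.lt_succ_iff.1 hk)
    rw [le_div_iff₀ (by positivity)] at this
    simp only [a]
    rw [div_le_one hpos]
    linarith
  have hlt : ∀ g ∈ L, ∀ j k, j < k → k < n → 2 * r ≤ ‖a k • w - a j • w - g‖ := by
    intro g hg j k hjk hk
    refine le_trans ?_ (le_norm_smul_sub_smul_sub (hmin g hg) (ha0 j) (ha1 k hk))
    have h1 : (j : ℝ) + 1 ≤ k := by exact_mod_cast hjk
    have h2 : (a k - a j) * ‖w‖ = 2 * r * (k - j) := by simp only [a]; field_simp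
    rw [h2]
    nlinarith
  have hsep : ∀ g ∈ L, ∀ j < n, ∀ k < n, ‖a k • w - a j • w - g‖ < 2 * r → j = k ∧ g = 0 := by
    intro g hg j hj k hk h
    rcases lt_trichotomy j k with hjk | rfl | hjk
    · exact absurd (hlt g hg j k hjk hk) h.not_ge
    · refine ⟨rfl, by_contra fun h0 => ?_⟩
      rw [sub_self, zero_sub, norm_neg] at h
      exact h.not_ge (hL g hg h0)
    · have := hlt (-g) (L.neg_mem hg) k j hjk hj
      rw [← norm_neg] at h
      refine absurd this (not_le.2 (lt_of_eq_of_lt ?_ h))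
      congr 1; abel
  have hsep' : ∀ g ∈ L, ∀ j < n, ∀ k < n, ∀ x ∈ ball (a k • w) r, ∀ y ∈ ball (a j • w) r,
      x = g + y → j = k ∧ g = 0 := by
    rintro g hg j hj k hk x hx y hy rfl
    refine hsep g hg j hj k hk ?_
    rw [mem_ball, dist_eq_norm] at hx hy
    have : a k • w - a j • w - g = (y - a j • w) - (g + y - a k • w) := by abel
    rw [this]
    linarith [norm_sub_le (y - a j • w) (g + y - a k • w)]
  have hμ : μ (⋃ k ∈ Finset.range n, ball (a k • w) r) = n * μ (ball 0 r) := by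
    rw [measure_biUnion_finset _ fun _ _ => measurableSet_ball]
    · simp [Measure.addHaar_ball_center]
    · intro k hk j hj hkj
      refine Set.disjoint_left.2 fun x hx hy => hkj ?_
      exact (hsep' 0 L.zero_mem j (by simpa using hj) k (by simpa using hk) x hx x hy
        (zero_add x).symm).1.symm
  have hle : (n : ℝ) * μ.real (ball 0 r) ≤ ZLattice.covolume L μ := by
    have := measure_le_covolume_of_pairwise_disjoint μ L
      (s := ⋃ k ∈ Finset.range n, ball (a k • w) r)
      (Finset.measurableSet_biUnion _ fun _ _ => measurableSet_ball) (by
        intro g hg x hx y hy hxy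
        simp only [Set.mem_iUnion, Finset.mem_range, exists_prop] at hx hy
        obtain ⟨k, hk, hx⟩ := hx
        obtain ⟨j, hj, hy⟩ := hy
        exact (hsep' g hg j hj k hk x hx y hy hxy).2)
    rw [hμ] at this
    have h2 := ENNReal.toReal_mono ENNReal.ofReal_ne_top this
    rwa [ENNReal.toReal_mul, ENNReal.toReal_natCast, ENNReal.toReal_ofReal hcov] at h2
  have hn' : ‖w‖ ≤ 2 * r * n := by
    have := (Nat.lt_floor_add_one (‖w‖ / (2 * r))).le
    rw [div_le_iff₀ (by positivity)] at this
    rw [hn]; push_cast; linarith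
  calc ‖w‖ * μ.real (ball 0 r) ≤ 2 * r * n * μ.real (ball 0 r) := by gcongr
    _ = 2 * r * (n * μ.real (ball 0 r)) := by ring
    _ ≤ _ := by gcongr

/-! ### Bounded fundamental domains and matching -/

/-- A lattice with covering radius at most `M` has a fundamental domain in the ball of
radius `M`. -/
theorem exists_fundamentalDomain_subset_closedBall {M : ℝ}
    (hM : ∀ z : E, ∃ l ∈ L, dist z l ≤ M) :
    ∃ F : Set E, MeasurableSet F ∧ (∀ z : E, ∃! g : L, g +ᵥ z ∈ F) ∧ F ⊆ closedBall 0 M := by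
  obtain ⟨F₀, hF₀, hu⟩ := exists_measurableSet_existsUnique_vadd_mem L
  obtain ⟨φ, hφ⟩ := exists_surjective_nat L
  -- `A n` holds the points for which `n` is the first index with `φ n` within `M`. Shifting each
  -- piece `F₀ ∩ A n` by `-φ n` moves it near `0` and keeps one representative per orbit.
  let A : ℕ → Set E := disjointed fun n => closedBall (φ n : E) M
  have hA : ∀ n, MeasurableSet (A n) :=
    MeasurableSet.disjointed fun _ => measurableSet_closedBall
  refine ⟨⋃ n, (fun w => (φ n : E) + w) ⁻¹' (F₀ ∩ A n), ?_, fun z => ?_, ?_⟩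
  · exact MeasurableSet.iUnion fun n => (measurable_const_add _) (hF₀.inter (hA n))
  · obtain ⟨g, hg, hgu⟩ := hu z
    obtain ⟨n, hn⟩ : ∃ n, (g +ᵥ z) ∈ A n := by
      rw [← Set.mem_iUnion, iUnion_disjointed, Set.mem_iUnion]
      obtain ⟨l, hl, hd⟩ := hM (g +ᵥ z)
      obtain ⟨n, hn⟩ := hφ ⟨l, hl⟩
      exact ⟨n, by rw [hn]; exact hd⟩
    have key : ∀ m (h : L), (φ m : E) + (h +ᵥ z) = (φ m + h) +ᵥ z := fun m h => by
      simp only [Submodule.vadd_def, vadd_eq_add, Submodule.coe_add, add_assoc]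
    refine ⟨g - φ n, Set.mem_iUnion.2 ⟨n, ?_⟩, fun h hh => ?_⟩
    · rw [Set.mem_preimage, key, add_sub_cancel]
      exact ⟨hg, hn⟩
    · obtain ⟨m, hm⟩ := Set.mem_iUnion.1 hh
      rw [Set.mem_preimage, key] at hm
      have h1 := hgu _ hm.1
      have hmn : m = n := by
        by_contra hne
        exact Set.disjoint_left.1 (disjoint_disjointed _ hne) hm.2 (h1 ▸ hn)
      rw [← h1, hmn, add_sub_cancel_left]
  · intro w hw
    obtain ⟨n, -, hw⟩ := Set.mem_iUnion.1 hw
    have := disjointed_subset _ _ hw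
    simpa [dist_eq_norm] using this

/-- Two lattices of the same covolume with bounded fundamental domains: Hall's theorem gives an
injection with bounded displacement. -/
theorem exists_injective_dist_le {L₁ L₂ : Submodule ℤ E} [DiscreteTopology L₁] [IsZLattice ℝ L₁]
    [DiscreteTopology L₂] [IsZLattice ℝ L₂]
    (hcov : ZLattice.covolume L₁ μ = ZLattice.covolume L₂ μ) {F₁ F₂ : Set E} {M₁ M₂ : ℝ}
    (hF₁ : MeasurableSet F₁) (hu₁ : ∀ z : E, ∃! g : L₁, g +ᵥ z ∈ F₁) (hM₁ : F₁ ⊆ closedBall 0 M₁)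
    (hF₂ : MeasurableSet F₂) (hu₂ : ∀ z : E, ∃! g : L₂, g +ᵥ z ∈ F₂)
    (hM₂ : F₂ ⊆ closedBall 0 M₂) :
    ∃ f : L₁ → L₂, Function.Injective f ∧ ∀ x : L₁, dist (x : E) (f x) ≤ M₁ + M₂ := by
  classical
  have hproper : ProperSpace E := FiniteDimensional.proper ℝ E
  have hfin : ∀ x : E, {y : L₂ | dist x y ≤ M₁ + M₂}.Finite := fun x => by
    let b := Module.Free.chooseBasis ℤ L₂
    have h := ZSpan.setFinite_inter (b.ofZLatticeBasis ℝ)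
      (isBounded_closedBall (x := x) (r := M₁ + M₂))
    rw [b.ofZLatticeBasis_span ℝ L₂] at h
    refine Set.Finite.of_finite_image (f := (↑)) (h.subset ?_) Subtype.val_injective.injOn
    rintro _ ⟨y, hy, rfl⟩
    exact ⟨by rwa [mem_closedBall, dist_comm], y.2⟩
  have hall := (Finset.all_card_le_biUnion_card_iff_exists_injective
    fun x : L₁ => (hfin x).toFinset).1 fun S => ?_
  · obtain ⟨f, hf, hd⟩ := hall
    exact ⟨f, hf, fun x => (hfin x).mem_toFinset.1 (hd x)⟩
  set T := S.biUnion fun x : L₁ => (hfin x).toFinset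
  set V := ENNReal.ofReal (ZLattice.covolume L₁ μ) with hV
  have hV₁ : μ F₁ = V := measure_eq_covolume_of_existsUnique μ hF₁ hu₁ hM₁
  have hV₂ : μ F₂ = V := by
    rw [hV, hcov]; exact measure_eq_covolume_of_existsUnique μ hF₂ hu₂ hM₂
  have hS : μ (⋃ x ∈ S, (fun z => -(x : E) + z) ⁻¹' F₁) = S.card * V := by
    rw [measure_biUnion_finset _ fun x _ => measurable_const_add _ hF₁]
    · simp [measure_preimage_add, hV₁]
    · intro x _ y _ hxy
      refine Set.disjoint_left.2 fun z hx hy => hxy (neg_injective ?_)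
      exact (hu₁ z).unique hx hy
  have hT : μ (⋃ y ∈ T, (fun z => -(y : E) + z) ⁻¹' F₂) ≤ T.card * V := by
    refine (measure_biUnion_finset_le _ _).trans_eq ?_
    simp [measure_preimage_add, hV₂]
  -- A point in the cells of both `x` and `y` forces `dist x y ≤ M₁ + M₂`, so `y` is an admissible
  -- partner of `x`.
  have hsub : (⋃ x ∈ S, (fun z => -(x : E) + z) ⁻¹' F₁) ⊆
      ⋃ y ∈ T, (fun z => -(y : E) + z) ⁻¹' F₂ := by
    intro z hz
    simp only [Set.mem_iUnion, Set.mem_preimage, exists_prop] at hz ⊢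
    obtain ⟨x, hx, hz⟩ := hz
    obtain ⟨g, hg, -⟩ := hu₂ z
    have hg' : -((-g : L₂) : E) + z ∈ F₂ := by
      rw [Submodule.coe_neg, neg_neg]; exact hg
    refine ⟨-g, ?_, hg'⟩
    refine Finset.mem_biUnion.2 ⟨x, hx, ?_⟩
    rw [Set.Finite.mem_toFinset, Set.mem_ofPred_eq]
    have h1 := mem_closedBall_zero_iff.1 (hM₁ hz)
    have h2 := mem_closedBall_zero_iff.1 (hM₂ hg')
    have h3 : (x : E) - ((-g : L₂) : E) = (-((-g : L₂) : E) + z) - (-(x : E) + z) := by abel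
    rw [dist_eq_norm, h3]
    linarith [norm_sub_le (-((-g : L₂) : E) + z) (-(x : E) + z)]
  have h := (hS.symm.trans_le (measure_mono hsub)).trans hT
  have hV0 : V ≠ 0 := by
    rw [hV]; exact (ENNReal.ofReal_pos.2 (ZLattice.covolume_pos L₁ μ)).ne'
  rw [ENNReal.mul_le_mul_iff_left hV0 ENNReal.ofReal_ne_top] at h
  exact_mod_cast h

/-- Two lattices of the same covolume with covering radii at most `M₁` and `M₂` are related by a
bijection of displacement at most `M₁ + M₂`. -/
theorem exists_equiv_dist_le {L₁ L₂ : Submodule ℤ E} [DiscreteTopology L₁] [IsZLattice ℝ L₁]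
    [DiscreteTopology L₂] [IsZLattice ℝ L₂]
    (hcov : ZLattice.covolume L₁ μ = ZLattice.covolume L₂ μ) {M₁ M₂ : ℝ}
    (hM₁ : ∀ z : E, ∃ l ∈ L₁, dist z l ≤ M₁) (hM₂ : ∀ z : E, ∃ l ∈ L₂, dist z l ≤ M₂) :
    ∃ f : L₁ ≃ L₂, ∀ x : L₁, dist (x : E) (f x) ≤ M₁ + M₂ := by
  obtain ⟨F₁, hF₁, hu₁, hb₁⟩ := exists_fundamentalDomain_subset_closedBall L₁ hM₁
  obtain ⟨F₂, hF₂, hu₂, hb₂⟩ := exists_fundamentalDomain_subset_closedBall L₂ hM₂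
  obtain ⟨f, hf, hfd⟩ := exists_injective_dist_le μ hcov hF₁ hu₁ hb₁ hF₂ hu₂ hb₂
  obtain ⟨g, hg, hgd⟩ := exists_injective_dist_le μ hcov.symm hF₂ hu₂ hb₂ hF₁ hu₁ hb₁
  -- The bijection only uses pairs matched by `f` or by `g`, so the displacement bound survives.
  obtain ⟨h, hh, hhd⟩ := Function.Embedding.schroeder_bernstein_of_rel hf hg
    (fun x y => dist (x : E) y ≤ M₁ + M₂) hfd fun y => by
      rw [dist_comm, add_comm]; exact hgd y
  exact ⟨Equiv.ofBijective h hh, hhd⟩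

end LatticeGeometry

/-! ### Explicit bounds in Euclidean space -/

theorem bottleneckDist_le_ofReal {d : ℕ} {X Y : Set (EuclideanSpace ℝ (Fin d))} {C : ℝ}
    (f : X ≃ Y) (hf : ∀ x : X, dist (x : EuclideanSpace ℝ (Fin d)) (f x) ≤ C) :
    bottleneckDist X Y ≤ ENNReal.ofReal C :=
  iInf_le_of_le f <| iSup_le fun x => by
    rw [edist_dist]; exact ENNReal.ofReal_le_ofReal (hf x)

theorem euclideanBottleneckDist_le_bottleneckDist {d : ℕ}
    (X Y : Set (EuclideanSpace ℝ (Fin d))) :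
    euclideanBottleneckDist X Y ≤ bottleneckDist X Y := by
  refine iInf_le_of_le (IsometryEquiv.refl _) ?_
  rw [show ⇑(IsometryEquiv.refl (EuclideanSpace ℝ (Fin d))) = id from rfl, Set.image_id]

theorem two_mul_le_norm_of_le_packingRadius {d : ℕ}
    {L : Submodule ℤ (EuclideanSpace ℝ (Fin d))} {r : ℝ}
    (h : ENNReal.ofReal r ≤ packingRadius (L : Set (EuclideanSpace ℝ (Fin d))))
    {g : EuclideanSpace ℝ (Fin d)} (hg : g ∈ L) (h0 : g ≠ 0) : 2 * r ≤ ‖g‖ := by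
  have h1 := Set.einfsep_le_edist_of_mem (s := (L : Set (EuclideanSpace ℝ (Fin d)))) hg
    L.zero_mem h0
  have h2 : ENNReal.ofReal r ≤ ENNReal.ofReal (‖g‖ / 2) := by
    refine h.trans ?_
    rw [packingRadius, ENNReal.ofReal_div_of_pos two_pos, ← dist_zero_right, ← edist_dist,
      ENNReal.ofReal_ofNat]
    gcongr
  rw [ENNReal.ofReal_le_ofReal_iff (by positivity)] at h2
  linarith

/-- A bound for the covering radius of a lattice in `ℝ^d` of covolume `V` and packing radius at
least `r`. -/
noncomputable def coveringBound (d : ℕ) (r V : ℝ) : ℝ :=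
  2 * V / (r ^ (d - 1) * volume.real (ball (0 : EuclideanSpace ℝ (Fin d)) 1))

theorem volume_real_unitBall_pos (d : ℕ) :
    0 < volume.real (ball (0 : EuclideanSpace ℝ (Fin d)) 1) :=
  ENNReal.toReal_pos (measure_ball_pos _ _ one_pos).ne' measure_ball_lt_top.ne

theorem coveringBound_nonneg (d : ℕ) {r V : ℝ} (hr : 0 < r) (hV : 0 ≤ V) :
    0 ≤ coveringBound d r V := by
  unfold coveringBound; positivity

theorem coveringBound_le_coveringBound (d : ℕ) {r r' V V' : ℝ} (hr : 0 < r) (hrr : r ≤ r')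
    (hV : 0 ≤ V') (hVV : V' ≤ V) : coveringBound d r' V' ≤ coveringBound d r V := by
  have := volume_real_unitBall_pos d
  have := hV.trans hVV
  unfold coveringBound
  gcongr

theorem exists_mem_lattice_dist_le_coveringBound {d : ℕ}
    (L : Submodule ℤ (EuclideanSpace ℝ (Fin d))) [DiscreteTopology L] [IsZLattice ℝ L] {r : ℝ}
    (hr : 0 < r) (hL : ∀ g ∈ L, g ≠ 0 → 2 * r ≤ ‖g‖) (z : EuclideanSpace ℝ (Fin d)) :
    ∃ l ∈ L, dist z l ≤ coveringBound d r (ZLattice.covolume L) := by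
  -- In dimension `0` the truncated `d - 1` breaks the cancellation `r ^ d = r ^ (d - 1) * r`, but
  -- the space is a point.
  rcases d with - | d
  · refine ⟨0, L.zero_mem, ?_⟩
    rw [Subsingleton.elim z 0, dist_self]
    exact coveringBound_nonneg 0 hr (ZLattice.covolume_pos L).le
  obtain ⟨l, hl, h⟩ := exists_mem_lattice_dist_mul_measure_ball_le volume L hr hL z
  refine ⟨l, hl, ?_⟩
  have hω := volume_real_unitBall_pos (d + 1)
  rw [measureReal_def, Measure.addHaar_ball _ _ hr.le, finrank_euclideanSpace_fin,
    ENNReal.toReal_mul, ENNReal.toReal_ofReal (by positivity), ← measureReal_def] at h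
  rw [coveringBound, add_tsub_cancel_right, le_div_iff₀ (by positivity)]
  rw [pow_succ] at h
  refine le_of_mul_le_mul_right ?_ hr
  linarith

/-! ### The scaled integer lattice -/

/-- The standard basis of `ℝ^d` scaled by a nonzero factor. -/
noncomputable def scaledBasis (d : ℕ) {c : ℝ} (hc : c ≠ 0) :
    Module.Basis (Fin d) ℝ (EuclideanSpace ℝ (Fin d)) :=
  (EuclideanSpace.basisFun (Fin d) ℝ).toBasis.isUnitSMul fun _ => hc.isUnit

theorem coe_span_scaledBasis (d : ℕ) {c : ℝ} (hc : c ≠ 0) :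
    (Submodule.span ℤ (Set.range (scaledBasis d hc)) : Set (EuclideanSpace ℝ (Fin d))) =
      c • integerLattice d := by
  ext x
  rw [SetLike.mem_coe, Module.Basis.mem_span_iff_repr_mem, Set.mem_smul_set_iff_inv_smul_mem₀ hc]
  refine forall_congr' fun i => ?_
  rw [scaledBasis, Module.Basis.repr_isUnitSMul]
  simp [Units.smul_def, eq_comm]

theorem covolume_span_scaledBasis (d : ℕ) {c : ℝ} (hc : 0 < c) :
    ZLattice.covolume (Submodule.span ℤ (Set.range (scaledBasis d hc.ne'))) = c ^ d := by
  rw [ZLattice.covolume_eq_measure_fundamentalDomain _ _ (ZSpan.isAddFundamentalDomain _ volume),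
    ZSpan.measureReal_fundamentalDomain _ _ (EuclideanSpace.basisFun (Fin d) ℝ).toBasis,
    measureReal_congr (ZSpan.fundamentalDomain_ae_parallelepiped _ volume),
    OrthonormalBasis.coe_toBasis, measureReal_def, OrthonormalBasis.volume_parallelepiped,
    scaledBasis, Module.Basis.det_isUnitSMul]
  simp [abs_of_pos hc]

/-- Rounding down leaves a fractional part bounded by the sum of the `d` basis norms, each equal to
`c`. -/
theorem exists_mem_span_scaledBasis_dist_le (d : ℕ) {c : ℝ} (hc : 0 < c)
    (z : EuclideanSpace ℝ (Fin d)) :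
    ∃ l ∈ Submodule.span ℤ (Set.range (scaledBasis d hc.ne')), dist z l ≤ d * c := by
  refine ⟨ZSpan.floor (scaledBasis d hc.ne') z, SetLike.coe_mem _, ?_⟩
  rw [dist_eq_norm, ← ZSpan.fract_apply]
  refine (ZSpan.norm_fract_le _ z).trans_eq ?_
  simp [scaledBasis, Module.Basis.isUnitSMul_apply, norm_smul, abs_of_pos hc]

/-! ### The two bounds -/

theorem covolume_eq_inv_of_mem_lattices {d : ℕ} {r κ : ℝ}
    {L : Submodule ℤ (EuclideanSpace ℝ (Fin d))} (hL : L ∈ lattices d r κ) :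
    ZLattice.covolume L = κ⁻¹ := by
  rw [← hL.2.2, latticeDensity, one_div, inv_inv]

theorem euclideanBottleneckDiam_lattices_le {d : ℕ} {r κ : ℝ} (hr : 0 < r) :
    euclideanBottleneckDiam (lattices d r κ) ≤
      ENNReal.ofReal (coveringBound d r κ⁻¹ + coveringBound d r κ⁻¹) := by
  refine iSup₂_le fun L₁ h₁ => iSup₂_le fun L₂ h₂ => ?_
  -- The identity isometry suffices.
  refine (euclideanBottleneckDist_le_bottleneckDist _ _).trans ?_
  have c₁ := covolume_eq_inv_of_mem_lattices h₁
  have c₂ := covolume_eq_inv_of_mem_lattices h₂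
  obtain ⟨⟨_, _⟩, p₁, -⟩ := h₁
  obtain ⟨⟨_, _⟩, p₂, -⟩ := h₂
  obtain ⟨f, hf⟩ := exists_equiv_dist_le volume (c₁.trans c₂.symm)
    (exists_mem_lattice_dist_le_coveringBound L₁ hr fun _ =>
      two_mul_le_norm_of_le_packingRadius p₁)
    (exists_mem_lattice_dist_le_coveringBound L₂ hr fun _ =>
      two_mul_le_norm_of_le_packingRadius p₂)
  rw [c₁, c₂] at hf
  exact bottleneckDist_le_ofReal f hf

theorem bottleneckDist_smul_integerLattice_le {d : ℕ} {r ρ : ℝ} (hr : 0 < r) (hρ : 0 < ρ)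
    {L : Submodule ℤ (EuclideanSpace ℝ (Fin d))} (hL : L ∈ lattices d r (ρ ^ d)) :
    bottleneckDist (L : Set (EuclideanSpace ℝ (Fin d))) (ρ⁻¹ • integerLattice d) ≤
      ENNReal.ofReal (coveringBound d r (ρ ^ d)⁻¹ + d * ρ⁻¹) := by
  have c₁ := covolume_eq_inv_of_mem_lattices hL
  obtain ⟨⟨_, _⟩, p, -⟩ := hL
  have hρ' := inv_pos.2 hρ
  obtain ⟨f, hf⟩ := exists_equiv_dist_le volume
    (c₁.trans ((inv_pow ρ d).symm.trans (covolume_span_scaledBasis d hρ').symm))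
    (exists_mem_lattice_dist_le_coveringBound L hr fun _ =>
      two_mul_le_norm_of_le_packingRadius p)
    (exists_mem_span_scaledBasis_dist_le d hρ')
  rw [c₁] at hf
  rw [← coe_span_scaledBasis d hρ'.ne']
  exact bottleneckDist_le_ofReal f hf

theorem mainTheorem5 (d : ℕ) :
    (∀ r κ : ℝ, 0 < r → 0 < κ → euclideanBottleneckDiam (lattices d r κ) < ∞) ∧
    ∃ c : ℝ → ℝ → ℝ≥0,
      (∀ r ρ : ℝ, 0 < r → 0 < ρ → ∀ L ∈ lattices d r (ρ ^ d),
        bottleneckDist (L : Set (EuclideanSpace ℝ (Fin d))) (ρ⁻¹ • integerLattice d) ≤ c r ρ) ∧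
      (∀ ρ : ℝ, 0 < ρ → AntitoneOn (fun r => c r ρ) (Set.Ioi 0)) ∧
      (∀ r : ℝ, 0 < r → AntitoneOn (fun ρ => c r ρ) (Set.Ioi 0)) := by
  refine ⟨fun r κ hr _ => (euclideanBottleneckDiam_lattices_le hr).trans_lt ENNReal.ofReal_lt_top,
    -- Sum of the two covering radius bounds; both are nonnegative for `r, ρ > 0`, so `toNNReal`
    -- truncates nothing there.
    fun r ρ => (coveringBound d r (ρ ^ d)⁻¹ + d * ρ⁻¹).toNNReal,
    fun r ρ hr hρ L hL => bottleneckDist_smul_integerLattice_le hr hρ hL, ?_, ?_⟩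
  · intro ρ hρ r hr r' _ hrr
    refine Real.toNNReal_le_toNNReal (add_le_add_left ?_ _)
    exact coveringBound_le_coveringBound d hr hrr (by positivity) le_rfl
  · intro r hr ρ hρ ρ' hρ' hρρ
    have hρ : 0 < ρ := hρ
    have hρ' : 0 < ρ' := hρ'
    refine Real.toNNReal_le_toNNReal (add_le_add ?_ (by gcongr))
    exact coveringBound_le_coveringBound d hr le_rfl (by positivity) (by gcongr)
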